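/- Let $A$ and $B$ be groups, let $\mathcal V$ be the variety of groups defined by a set $V$ of laws, and let $c\ge 1$. Let $C=\prod^{*}_{b\in B}A_b$ be the free product of copies $A_b$ of $A$, where $a_b\in A_b$ corresponds to $a\in A$. Let $[A_b]^*$ be its cartesian subgroup (generated by all $[x,y]$ with $x\in A_b^C$, $y\in A_{b'}^C$, $b\ne b'$), where $X^E$ denotes the normal closure of $X$ in the group $E$. Put $C_V=V(C)\cap[A_b]^*$, where $V(\cdot)$ denotes the verbal subgroup. The verbal product is $G_V=C/C_V$, and the $\mathcal V$-verbal wreath product $A\,Wr_V B$ is the semidirect product of $G_V$ by $B$, where $b'\in B$ acts (on the right) by $\bar a_b\mapsto \bar a_{bb'}$. For a group $G$ with a free presentation $G\cong P/R$, let $\mathcal N_cM(G)=\dfrac{R\cap\gamma_{c+1}(P)}{[R,\,{}_cP]}$ be its $c$-nilpotent multiplier, where $[R,{}_cP]=[R,P,\dots,P]$ with $c$ copies of $P$; up to isomorphism it does not depend on the presentation. Let $1\to R_1\to F_1\xrightarrow{\nu_1}A\to1$ and $1\to R_2\to F_2\xrightarrow{\nu_2}B\to1$ be free presentations, and let $F=F_1*F_2$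 and $H=F_1^F$. Put $S_V=[R_2,F_1]^F\,R_1^F\,R_V$, where $$R_V=V(H)\cap\big\langle[x,y] : x\in(F_1^{u})^H,\ y\in(F_1^{v})^H,\ u,v\in F_2,\ \nu_2(u)\ne\nu_2(v)\big\rangle ,\qquad F_1^u=u^{-1}F_1u .$$ Let $K=F_1*B$, let $\delta:F\to K$ be the epimorphism induced by $\nu_2$ and the identity of $F_1$, and put $T_V=\delta(S_V)$. **Theorem 4.5.** There exists an epimorphism $$\mathcal N_cM(A\,Wr_V B)\twoheadrightarrow \mathcal N_cM(B)\oplus\frac{T_V\cap\gamma_{c+1}(K)}{[T_V,\,{}_cK]} .$$ Moreover, if $A\,Wr_V B$ is finite, then $\mathcal N_cM(A\,Wr_V B)$ is finite; and whenever $\mathcal N_cM(A\,Wr_V B)$ is finite, it has a subgroup isomorphic to $$\mathcal N_cM(B)\oplus\frac{T_V\cap\gamma_{c+1}(K)}{[T_V,\,{}_cK]} .$$ -/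

import Mathlib

open Monoid

/-- The verbal subgroup `V(G)`, for a set `V` of words in countably many variables: the subgroup
generated by all values in `G` of the words in `V`. -/
def verbalSubgroup (V : Set (FreeGroup ℕ)) (G : Type*) [Group G] : Subgroup G :=
  Subgroup.closure {x | ∃ v ∈ V, ∃ g : ℕ → G, FreeGroup.lift g v = x}

theorem verbalSubgroup_map_le (V : Set (FreeGroup ℕ)) {G H : Type*} [Group G] [Group H]
    (f : G →* H) : (verbalSubgroup V G).map f ≤ verbalSubgroup V H := by
  rw [verbalSubgroup, MonoidHom.map_closure, Subgroup.closure_le]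
  rintro _ ⟨_, ⟨v, hv, g, rfl⟩, rfl⟩
  refine Subgroup.subset_closure ⟨v, hv, fun n => f (g n), ?_⟩
  have h : FreeGroup.lift (fun n => f (g n)) = f.comp (FreeGroup.lift g) := by
    ext n; simp
  rw [h]; rfl

theorem normal_of_conj_map_le {G : Type*} [Group G] (N : Subgroup G)
    (h : ∀ g : G, N.map (MulAut.conj g).toMonoidHom ≤ N) : N.Normal :=
  ⟨fun n hn g => h g ⟨n, hn, by simp⟩⟩

instance verbalSubgroup_normal (V : Set (FreeGroup ℕ)) (G : Type*) [Group G] :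
    (verbalSubgroup V G).Normal :=
  normal_of_conj_map_le _ fun _ => verbalSubgroup_map_le V _

/-- For a family `S` of subgroups of `G`, the subgroup generated by all the commutators `[x, y]`
with `x` in the normal closure of `S i`, `y` in the normal closure of `S j`, and `r i j`.
If `G` is the free product of the `S i` and `r` is `≠`, this is the cartesian subgroup. -/
def mutualCommutator {G ι : Type*} [Group G] (r : ι → ι → Prop) (S : ι → Subgroup G) :
    Subgroup G :=
  ⨆ (i : ι) (j : ι) (_ : r i j),
    ⁅Subgroup.normalClosure (S i : Set G), Subgroup.normalClosure (S j : Set G)⁆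

theorem normalClosure_map_le {G H : Type*} [Group G] [Group H] (e : G ≃* H)
    (S : Subgroup G) (T : Subgroup H) (h : S.map e.toMonoidHom ≤ T) :
    (Subgroup.normalClosure (S : Set G)).map e.toMonoidHom ≤
      Subgroup.normalClosure (T : Set H) := by
  rw [Subgroup.map_normalClosure _ _ e.surjective]
  exact Subgroup.normalClosure_mono h

theorem mutualCommutator_map_le {G H ι κ : Type*} [Group G] [Group H] (e : G ≃* H)
    (r : ι → ι → Prop) (s : κ → κ → Prop) (S : ι → Subgroup G) (T : κ → Subgroup H) (p : ι → κ)
    (hp : ∀ i j, r i j → s (p i) (p j)) (h : ∀ i, (S i).map e.toMonoidHom ≤ T (p i)) :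
    (mutualCommutator r S).map e.toMonoidHom ≤ mutualCommutator s T := by
  simp only [mutualCommutator, Subgroup.map_iSup, Subgroup.map_commutator]
  refine iSup_le fun i => iSup_le fun j => iSup_le fun hij => ?_
  refine le_trans (Subgroup.commutator_mono (normalClosure_map_le e _ _ (h i))
    (normalClosure_map_le e _ _ (h j))) ?_
  exact le_iSup_of_le (p i) (le_iSup_of_le (p j) (le_iSup_of_le (hp i j hij) le_rfl))

instance mutualCommutator_normal {G ι : Type*} [Group G] (r : ι → ι → Prop)
    (S : ι → Subgroup G) : (mutualCommutator r S).Normal := by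
  refine normal_of_conj_map_le _ fun g => ?_
  simp only [mutualCommutator, Subgroup.map_iSup]
  refine iSup_le fun i => iSup_le fun j => iSup_le fun hij => ?_
  refine le_iSup_of_le i (le_iSup_of_le j (le_iSup_of_le hij ?_))
  rintro _ ⟨x, hx, rfl⟩
  exact (Subgroup.commutator_normal _ _).conj_mem x hx g

/-! ### The verbal wreath product -/

section VerbalWreath

variable (V : Set (FreeGroup ℕ)) (A B : Type*) [Group A] [Group B]

/-- The free product `C` of copies `A_b` of `A`, one for each `b ∈ B`; the element `a_b` is
`CoprodI.of (i := b) a`. -/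
abbrev CopiesProd : Type _ := CoprodI (fun _ : B => A)

/-- The endomorphism of `C` with `a_x ↦ a_{x b}`. -/
def copiesShiftHom (b : B) : CopiesProd A B →* CopiesProd A B :=
  CoprodI.lift fun x => CoprodI.of (M := fun _ : B => A) (i := x * b)

theorem copiesShiftHom_comp (b b' : B) :
    (copiesShiftHom A B b).comp (copiesShiftHom A B b') = copiesShiftHom A B (b' * b) := by
  refine CoprodI.ext_hom _ _ fun x => MonoidHom.ext fun a => ?_
  simp [copiesShiftHom, mul_assoc]

theorem copiesShiftHom_one : copiesShiftHom A B 1 = MonoidHom.id _ := by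
  refine CoprodI.ext_hom _ _ fun x => MonoidHom.ext fun a => ?_
  simp [copiesShiftHom]

/-- The automorphism of `C` with `a_x ↦ a_{x b}`. -/
def copiesShift (b : B) : MulAut (CopiesProd A B) :=
  MonoidHom.toMulEquiv (copiesShiftHom A B b) (copiesShiftHom A B b⁻¹)
    (by rw [copiesShiftHom_comp, mul_inv_cancel, copiesShiftHom_one])
    (by rw [copiesShiftHom_comp, inv_mul_cancel, copiesShiftHom_one])

/-- The cartesian subgroup `[A_b]^*` of the free product `C`. -/
def copiesCartesian : Subgroup (CopiesProd A B) :=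
  mutualCommutator (· ≠ ·) fun b : B => (CoprodI.of (M := fun _ : B => A) (i := b)).range

/-- The subgroup `C_V = V(C) ∩ [A_b]^*`. -/
def copiesVerbal : Subgroup (CopiesProd A B) :=
  verbalSubgroup V (CopiesProd A B) ⊓ copiesCartesian A B

instance copiesVerbal_normal : (copiesVerbal V A B).Normal :=
  have : (copiesCartesian A B).Normal := mutualCommutator_normal _ _
  Subgroup.normal_inf_normal _ _

theorem copiesVerbal_map_le (b : B) :
    (copiesVerbal V A B).map (copiesShift A B b).toMonoidHom ≤ copiesVerbal V A B := by
  refine le_trans (Subgroup.map_inf_le _ _ _) (inf_le_inf (verbalSubgroup_map_le V _) ?_)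
  refine mutualCommutator_map_le _ _ _ _ _ (fun x => x * b) (fun i j h => ?_) fun x => ?_
  · simpa using h
  · rintro _ ⟨_, ⟨a, rfl⟩, rfl⟩
    exact ⟨a, by simp [copiesShift, copiesShiftHom]⟩

theorem copiesVerbal_map_eq (b : B) :
    (copiesVerbal V A B).map (copiesShift A B b : CopiesProd A B →* CopiesProd A B) =
      copiesVerbal V A B := by
  refine le_antisymm (copiesVerbal_map_le V A B b) fun x hx => ?_
  refine ⟨copiesShift A B b⁻¹ x, copiesVerbal_map_le V A B b⁻¹ ⟨x, hx, rfl⟩, ?_⟩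
  have := DFunLike.congr_fun (copiesShiftHom_comp A B b b⁻¹) x
  rw [inv_mul_cancel, copiesShiftHom_one] at this
  exact this

/-- The verbal product `G_V = C / C_V` of the copies `A_b`, `b ∈ B`. -/
abbrev VerbalProd : Type _ := CopiesProd A B ⧸ copiesVerbal V A B

/-- The action of `B` on the verbal product. The exponent in `a_x ↦ a_{x b⁻¹}` makes it a left
action; in the semidirect product it gives `b⁻¹ a_x b = a_{x b}`, which is the right action
`a_x ↦ a_{x b}` of `B`. -/
def verbalAction : B →* MulAut (VerbalProd V A B) where
  toFun b := QuotientGroup.congr _ _ (copiesShift A B b⁻¹) (copiesVerbal_map_eq V A B b⁻¹)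
  map_one' := by
    ext x
    induction x using QuotientGroup.induction_on with
    | H x =>
      have := DFunLike.congr_fun (copiesShiftHom_one A B) x
      rw [QuotientGroup.congr_mk]
      simpa [copiesShift] using congrArg (QuotientGroup.mk (s := copiesVerbal V A B)) this
  map_mul' b b' := by
    ext x
    induction x using QuotientGroup.induction_on with
    | H x =>
      have := DFunLike.congr_fun (copiesShiftHom_comp A B b⁻¹ b'⁻¹) x
      rw [← mul_inv_rev] at this
      rw [MulAut.mul_apply, QuotientGroup.congr_mk, QuotientGroup.congr_mk,
        QuotientGroup.congr_mk]
      exact congrArg (QuotientGroup.mk (s := copiesVerbal V A B)) this.symm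

/-- The `𝒱`-verbal wreath product `A Wr_V B`, the semidirect product of `G_V` by `B`, where `𝒱`
is the variety with the set of laws `V`. -/
abbrev VerbalWreath : Type _ := VerbalProd V A B ⋊[verbalAction V A B] B

end VerbalWreath

/-! ### Iterated commutators and the `c`-nilpotent multiplier -/

/-- The iterated commutator subgroup `[N, _c E] = [N, E, …, E]`, with `c` copies of `E`. -/
def iterComm {E : Type*} [Group E] (N : Subgroup E) : ℕ → Subgroup E
  | 0 => N
  | c + 1 => ⁅iterComm N c, ⊤⁆

theorem iterComm_normal {E : Type*} [Group E] (N : Subgroup E) (hN : N.Normal) (c : ℕ) :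
    (iterComm N c).Normal := by
  induction c with
  | zero => exact hN
  | succ c ih => exact Subgroup.commutator_normal _ _

/-- The group `(N ∩ γ_{c+1}(E)) / [N, _c E]` for a normal subgroup `N` of `E`. Mathlib's lower
central series starts at index `0`, so that its term of index `c` is `γ_{c+1}`. The subgroup
`[N, _c E]` is contained in `N ∩ γ_{c+1}(E)`. -/
def GammaQuotient {E : Type*} [Group E] (c : ℕ) (N : Subgroup E) (_hN : N.Normal) : Type _ :=
  ↥(N ⊓ (⊤ : Subgroup E).lowerCentralSeries c) ⧸
    (iterComm N c).subgroupOf (N ⊓ (⊤ : Subgroup E).lowerCentralSeries c)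

instance GammaQuotient.group {E : Type*} [Group E] (c : ℕ) (N : Subgroup E) (hN : N.Normal) :
    Group (GammaQuotient c N hN) :=
  haveI := iterComm_normal N hN c
  inferInstanceAs (Group (_ ⧸ (iterComm N c).subgroupOf _))

theorem iterComm_le {E : Type*} [Group E] (N : Subgroup E) (hN : N.Normal) (c : ℕ) :
    iterComm N c ≤ N ⊓ (⊤ : Subgroup E).lowerCentralSeries c := by
  induction c with
  | zero => exact le_inf le_rfl le_top
  | succ c ih =>
    refine le_inf ?_ (Subgroup.commutator_mono (ih.trans inf_le_right) le_rfl)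
    exact (Subgroup.commutator_mono (ih.trans inf_le_left) le_rfl).trans
      (Subgroup.commutator_le_left _ _)

/-- The `c`-nilpotent multiplier `𝒩_c M(G) = (R ∩ γ_{c+1}(P)) / [R, _c P]` of `G`, the Baer
invariant of `G` with respect to the variety of nilpotent groups of class at most `c`, computed
from a free presentation `π : P → G` with kernel `R`. -/
abbrev NilpotentMultiplier {P G : Type*} [Group P] [Group G] (c : ℕ) (π : P →* G) : Type _ :=
  GammaQuotient c π.ker (MonoidHom.normal_ker π)

/-! ### The subgroups `S_V` and `T_V` -/

section Relators

variable (V : Set (FreeGroup ℕ)) {A B F₁ F₂ : Type*} [Group A] [Group B] [Group F₁] [Group F₂]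
  (ν₁ : F₁ →* A) (ν₂ : F₂ →* B)

variable (F₁ F₂) in
/-- The normal closure `H = F₁^F` of `F₁` in the free product `F = F₁ * F₂`. -/
def freeBase : Subgroup (Coprod F₁ F₂) :=
  Subgroup.normalClosure ((Coprod.inl : F₁ →* Coprod F₁ F₂).range : Set (Coprod F₁ F₂))

instance freeBase_normal : (freeBase F₁ F₂).Normal := Subgroup.normalClosure_normal

variable (F₁) in
/-- The conjugate `F₁^u = u⁻¹ F₁ u` for `u ∈ F₂`, as a subgroup of `H`. -/
def conjCopy (u : F₂) : Subgroup (freeBase F₁ F₂) :=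
  ((Coprod.inl : F₁ →* Coprod F₁ F₂).range.map
    (MulAut.conj (Coprod.inr u)⁻¹).toMonoidHom).subgroupOf (freeBase F₁ F₂)

/-- The intersection of `V(H)` with the subgroup of `H` generated by the commutators `[x, y]`,
`x ∈ (F₁^u)^H`, `y ∈ (F₁^v)^H`, where `u, v ∈ F₂` have different images in `B`,
as a subgroup of `H`. -/
def verbalRelInner : Subgroup (freeBase F₁ F₂) :=
  verbalSubgroup V (freeBase F₁ F₂) ⊓
    mutualCommutator (fun u v : F₂ => ν₂ u ≠ ν₂ v) (conjCopy F₁)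

variable (F₁) in
/-- The subgroup `R_V` of `F`. -/
def verbalRel : Subgroup (Coprod F₁ F₂) :=
  (verbalRelInner V (F₁ := F₁) ν₂).map (freeBase F₁ F₂).subtype

theorem conjCopy_map_le (u w : F₂) :
    (conjCopy F₁ u).map
      (MulAut.conjNormal (H := freeBase F₁ F₂) (Coprod.inr w)).toMonoidHom ≤
      conjCopy F₁ (u * w⁻¹) := by
  rintro _ ⟨x, ⟨_, ⟨f, rfl⟩, hx⟩, rfl⟩
  refine ⟨_, ⟨f, rfl⟩, ?_⟩
  have h : (Coprod.inr u)⁻¹ * Coprod.inl f * Coprod.inr u = (x : Coprod F₁ F₂) := by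
    simpa using hx
  simp [← h, mul_assoc]

theorem verbalRelInner_map_le (g : Coprod F₁ F₂) :
    (verbalRelInner V (F₁ := F₁) ν₂).map
      (MulAut.conjNormal (H := freeBase F₁ F₂) g).toMonoidHom ≤ verbalRelInner V ν₂ := by
  have hmul : ∀ x y : Coprod F₁ F₂,
      (MulAut.conjNormal (H := freeBase F₁ F₂) (x * y)).toMonoidHom =
        (MulAut.conjNormal x).toMonoidHom.comp (MulAut.conjNormal y).toMonoidHom := by
    intro x y; rw [map_mul]; rfl
  induction g using Coprod.induction_on with
  | inl f =>
    have hf : Coprod.inl f ∈ freeBase F₁ F₂ := Subgroup.subset_normalClosure ⟨f, rfl⟩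
    have : (verbalRelInner V (F₁ := F₁) ν₂).Normal := Subgroup.normal_inf_normal _ _
    rintro _ ⟨x, hx, rfl⟩
    have h := this.conj_mem x hx ⟨_, hf⟩
    convert h using 1
    exact Subtype.ext (by simp)
  | inr w =>
    refine le_trans (Subgroup.map_inf_le _ _ _) (inf_le_inf (verbalSubgroup_map_le V _) ?_)
    refine mutualCommutator_map_le _ _ _ _ _ (fun u => u * w⁻¹) (fun i j h => ?_)
      fun u => conjCopy_map_le u w
    simpa using h
  | mul x y hx hy =>
    rw [hmul, ← Subgroup.map_map]
    exact (Subgroup.map_mono hy).trans hx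

instance verbalRel_normal : (verbalRel V F₁ ν₂).Normal := by
  refine ⟨?_⟩
  rintro _ ⟨x, hx, rfl⟩ g
  exact ⟨_, verbalRelInner_map_le V ν₂ g ⟨x, hx, rfl⟩, by simp⟩

/-- The normal subgroup `S_V = [R₂, F₁]^F R₁^F R_V` of `F = F₁ * F₂`, where `R₁` and `R₂` are
the kernels of `ν₁` and `ν₂`. -/
def verbalS : Subgroup (Coprod F₁ F₂) :=
  Subgroup.normalClosure
      ((⁅ν₂.ker.map (Coprod.inr : F₂ →* Coprod F₁ F₂),
        (Coprod.inl : F₁ →* Coprod F₁ F₂).range⁆ : Subgroup (Coprod F₁ F₂)) :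
        Set (Coprod F₁ F₂)) ⊔
    Subgroup.normalClosure
      ((ν₁.ker.map (Coprod.inl : F₁ →* Coprod F₁ F₂) : Subgroup (Coprod F₁ F₂)) :
        Set (Coprod F₁ F₂)) ⊔
    verbalRel V F₁ ν₂

instance verbalS_normal : (verbalS V ν₁ ν₂).Normal :=
  have _h : ∀ s : Set (Coprod F₁ F₂), (Subgroup.normalClosure s).Normal :=
    fun _ => Subgroup.normalClosure_normal
  Subgroup.sup_normal _ _

variable (F₁) in
/-- The homomorphism `δ : F₁ * F₂ → F₁ * B = K`. -/
def deltaHom : Coprod F₁ F₂ →* Coprod F₁ B := Coprod.map (MonoidHom.id F₁) ν₂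

theorem deltaHom_surjective (h : Function.Surjective ν₂) :
    Function.Surjective (deltaHom F₁ ν₂) := by
  intro x
  induction x using Coprod.induction_on with
  | inl f => exact ⟨Coprod.inl f, by simp [deltaHom]⟩
  | inr b =>
    obtain ⟨w, rfl⟩ := h b
    exact ⟨Coprod.inr w, by simp [deltaHom]⟩
  | mul x y hx hy =>
    obtain ⟨u, rfl⟩ := hx
    obtain ⟨v, rfl⟩ := hy
    exact ⟨u * v, map_mul _ _ _⟩

/-- The subgroup `T_V = δ(S_V)` of `K = F₁ * B`. -/
def verbalT : Subgroup (Coprod F₁ B) := (verbalS V ν₁ ν₂).map (deltaHom F₁ ν₂)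

theorem verbalT_normal (h : Function.Surjective ν₂) : (verbalT V ν₁ ν₂).Normal :=
  (verbalS_normal V ν₁ ν₂).map _ (deltaHom_surjective ν₂ h)

end Relators

/-! ### Commutator calculus modulo `[N, _c E]` -/

open scoped commutatorElement

/-! Write `W` for `A Wr_V B`. Two facts carry the epimorphism. First, `T_V` is the kernel of the
natural map `K → W` (`ker_coprodToWreath`). The inclusion `ker ≤ T_V` needs every element of `C_V`
to come from the analogous subgroup for copies of `F₁`; an arbitrary verbal lift is corrected by its
components, which are verbal and die in `C` (`exists_mem_copiesVerbal_copiesMap_eq`).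

Second, homomorphisms that agree modulo `N` agree on `γ_{c+1}` modulo `[N, _c E]`
(`inv_mul_mem_iterComm`). So maps between presentations of the same group are mutually inverse on
multipliers, and all comparisons may pass through `F = F₁ * F₂`, which lifts through surjections.
The two coordinates of the epimorphism come from the retraction `F → F₂` and from `δ : F → K`. They
are jointly onto because an element can be multiplied by a suitable element of `F₂` that `δ` kills,
which fixes the first coordinate without moving the second.

Finiteness of the multiplier is Baer's theorem, applied in `P / [R, _c P]`. The subgroup statement
holds because the groups involved are abelian (`GammaQuotient.mul_comm`), and by duality a quotient
of a finite abelian group embeds in it. -/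

theorem Subgroup.commutator_commutator_le_of_rotate {G : Type*} [Group G] {H₁ H₂ H₃ L : Subgroup G}
    [L.Normal] (h₁ : ⁅⁅H₂, H₃⁆, H₁⁆ ≤ L) (h₂ : ⁅⁅H₃, H₁⁆, H₂⁆ ≤ L) : ⁅⁅H₁, H₂⁆, H₃⁆ ≤ L := by
  have key : ∀ M : Subgroup G, M.map (QuotientGroup.mk' L) = ⊥ ↔ M ≤ L := fun M => by
    rw [Subgroup.map_eq_bot_iff, QuotientGroup.ker_mk']
  rw [← key, Subgroup.map_commutator, Subgroup.map_commutator] at *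
  exact Subgroup.commutator_commutator_eq_bot_of_rotate h₁ h₂

/-- Three subgroups lemma, by induction on `k`. The claim is for all `j` because one rotated term is
`[[N, _{j+1} E], γ_{k+1}(E)]`. -/
theorem commutator_iterComm_lowerCentralSeries_le {E : Type*} [Group E] (N : Subgroup E)
    (hN : N.Normal) (k : ℕ) : ∀ j : ℕ,
    ⁅iterComm N j, (⊤ : Subgroup E).lowerCentralSeries k⁆ ≤ iterComm N (j + k + 1) := by
  induction k with
  | zero => exact fun j => le_rfl
  | succ k ih =>
    intro j
    have := iterComm_normal N hN (j + (k + 1) + 1)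
    rw [Subgroup.commutator_comm, Subgroup.lowerCentralSeries_succ]
    refine Subgroup.commutator_commutator_le_of_rotate ?_ ?_
    · rw [Subgroup.commutator_comm ⊤]
      exact (ih (j + 1)).trans (by rw [show j + 1 + k + 1 = j + (k + 1) + 1 by ring])
    · exact Subgroup.commutator_mono (ih j) le_rfl

theorem iterComm_succ_le {E : Type*} [Group E] (N : Subgroup E) (hN : N.Normal) (c : ℕ) :
    iterComm N (c + 1) ≤ iterComm N c :=
  have := iterComm_normal N hN c
  Subgroup.commutator_le_left _ _

theorem iterComm_map_le {E E' : Type*} [Group E] [Group E'] (f : E →* E') {N : Subgroup E}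
    {N' : Subgroup E'} (h : N.map f ≤ N') (c : ℕ) : (iterComm N c).map f ≤ iterComm N' c := by
  induction c with
  | zero => exact h
  | succ c ih =>
    rw [iterComm, Subgroup.map_commutator]
    exact Subgroup.commutator_mono ih le_top

theorem iterComm_map_eq {E E' : Type*} [Group E] [Group E'] (f : E →* E')
    (hf : Function.Surjective f) (N : Subgroup E) (c : ℕ) :
    iterComm (N.map f) c = (iterComm N c).map f := by
  induction c with
  | zero => rfl
  | succ c ih =>
    rw [iterComm, iterComm, Subgroup.map_commutator, ih, Subgroup.map_top_of_surjective f hf]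

theorem lowerCentralSeries_top_map_le {E E' : Type*} [Group E] [Group E'] (f : E →* E') (c : ℕ) :
    ((⊤ : Subgroup E).lowerCentralSeries c).map f ≤ (⊤ : Subgroup E').lowerCentralSeries c := by
  rw [Subgroup.map_lowerCentralSeries]
  exact Subgroup.lowerCentralSeries_mono c le_top

theorem lowerCentralSeries_top_map_eq {E E' : Type*} [Group E] [Group E'] (f : E →* E')
    (hf : Function.Surjective f) (c : ℕ) :
    ((⊤ : Subgroup E).lowerCentralSeries c).map f = (⊤ : Subgroup E').lowerCentralSeries c := by
  rw [Subgroup.map_lowerCentralSeries, Subgroup.map_top_of_surjective f hf]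

/-- Two homomorphisms that agree modulo `N` agree modulo `[N, _c E]` on `γ_{c+1}`. -/
theorem inv_mul_mem_iterComm {P E : Type*} [Group P] [Group E] (f g : P →* E) (N : Subgroup E)
    (hN : N.Normal) (h : ∀ x, (f x)⁻¹ * g x ∈ N) (c : ℕ) {x : P}
    (hx : x ∈ (⊤ : Subgroup P).lowerCentralSeries c) : (f x)⁻¹ * g x ∈ iterComm N c := by
  induction c generalizing x with
  | zero => exact h x
  | succ k ih =>
    have hL := iterComm_normal N hN (k + 1)
    let q := QuotientGroup.mk' (iterComm N (k + 1))
    have hcomm : ∀ {u v : E}, ⁅u, v⁆ ∈ iterComm N (k + 1) → Commute (q u) (q v) := by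
      intro u v huv
      rw [← commutatorElement_eq_one_iff_commute, ← map_commutatorElement]
      exact (QuotientGroup.eq_one_iff _).2 huv
    suffices hle : (⊤ : Subgroup P).lowerCentralSeries (k + 1) ≤
        (q.comp f).eqLocus (q.comp g) from QuotientGroup.eq.1 (hle hx)
    rw [Subgroup.lowerCentralSeries_succ, Subgroup.commutator_le]
    intro x hx y _
    change q (f ⁅x, y⁆) = q (g ⁅x, y⁆)
    -- Modulo `[N, _{k+1} E]` the discrepancy at `x` is central. The one at `y` lies only in `N`,
    -- but it commutes with `f x ∈ γ_{k+1}(E)`, so neither changes the commutator.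
    have hn : ∀ u, Commute (q ((f x)⁻¹ * g x)) (q u) := fun u =>
      hcomm (Subgroup.commutator_mem_commutator (ih hx) (Subgroup.mem_top u))
    have hm : Commute (q ((f y)⁻¹ * g y)) (q (f x)) :=
      hcomm (((commutator_iterComm_lowerCentralSeries_le N hN k 0).trans_eq (by rw [zero_add]))
        (Subgroup.commutator_mem_commutator (h y)
          (lowerCentralSeries_top_map_le f k ⟨x, hx, rfl⟩)))
    have hgx : q (g x) = q (f x) * q ((f x)⁻¹ * g x) := by rw [← map_mul, mul_inv_cancel_left]
    have hgy : q (g y) = q (f y) * q ((f y)⁻¹ * g y) := by rw [← map_mul, mul_inv_cancel_left]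
    have h1 := hn (f x)
    have h2 := hn (g y)
    simp only [map_commutatorElement]
    have e1 : ⁅q (g x), q (g y)⁆ = ⁅q (f x), q (g y)⁆ := by
      rw [hgx, commutatorElement_def, commutatorElement_def, mul_assoc (q (f x)), h2.eq]
      group
    have e2 : ⁅q (f x), q (g y)⁆ = ⁅q (f x), q (f y)⁆ := by
      rw [hgy, commutatorElement_def, commutatorElement_def]
      have := hm.inv_right.eq
      calc _ = q (f x) * q (f y) * (q ((f y)⁻¹ * g y) * (q (f x))⁻¹)
            * (q ((f y)⁻¹ * g y))⁻¹ * (q (f y))⁻¹ := by group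
        _ = _ := by rw [this]; group
    rw [e1, e2]

namespace GammaQuotient

variable {E E' : Type*} [Group E] [Group E'] {c : ℕ} {N : Subgroup E} {N' : Subgroup E'}

/-- The class of an element of `N ∩ γ_{c+1}(E)`. -/
def mk (hN : N.Normal) : ↥(N ⊓ (⊤ : Subgroup E).lowerCentralSeries c) →* GammaQuotient c N hN :=
  haveI := iterComm_normal N hN c
  QuotientGroup.mk' ((iterComm N c).subgroupOf _)

theorem mk_surjective (hN : N.Normal) : Function.Surjective (mk (c := c) hN) :=
  haveI := iterComm_normal N hN c
  QuotientGroup.mk'_surjective _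

theorem mk_eq_iff (hN : N.Normal) {x y : ↥(N ⊓ (⊤ : Subgroup E).lowerCentralSeries c)} :
    mk hN x = mk hN y ↔ (x : E)⁻¹ * y ∈ iterComm N c :=
  haveI := iterComm_normal N hN c
  QuotientGroup.eq

theorem mul_comm (hN : N.Normal) (x y : GammaQuotient c N hN) : x * y = y * x := by
  obtain ⟨x, rfl⟩ := mk_surjective hN x
  obtain ⟨y, rfl⟩ := mk_surjective hN y
  rw [← map_mul, ← map_mul, mk_eq_iff]
  have h : ⁅(y : E)⁻¹, (x : E)⁻¹⁆ ∈ iterComm N (c + 1) :=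
    ((commutator_iterComm_lowerCentralSeries_le N hN c 0).trans_eq (by rw [zero_add]))
      (Subgroup.commutator_mem_commutator (inv_mem y.2.1) (inv_mem x.2.2))
  convert iterComm_succ_le N hN c h using 1
  simp [commutatorElement_def, mul_assoc]

/-- The homomorphism induced by `f : E → E'` with `f(N) ≤ N'`. -/
def map (hN : N.Normal) (hN' : N'.Normal) (f : E →* E') (h : N.map f ≤ N') :
    GammaQuotient c N hN →* GammaQuotient c N' hN' :=
  haveI := iterComm_normal N hN c
  haveI := iterComm_normal N' hN' c
  QuotientGroup.map _ _
    ((f.comp (Subgroup.subtype _)).codRestrict (N' ⊓ (⊤ : Subgroup E').lowerCentralSeries c)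
      fun x => ⟨h ⟨x, x.2.1, rfl⟩, lowerCentralSeries_top_map_le f c ⟨x, x.2.2, rfl⟩⟩)
    fun x hx => iterComm_map_le f h c ⟨x, hx, rfl⟩

end GammaQuotient

/-! ### Baer's finiteness theorem -/

/-- If `Z` is central, `N` centralizes `M` and has finite index, and `M` is finite modulo `Z`, then
there are only finitely many commutators `[m, e]` with `m ∈ M`. -/
theorem finite_commutatorElement_set {E : Type*} [Group E] (M Z N : Subgroup E) [Z.Normal]
    (hZ : Z ≤ Subgroup.center E) (hMZ : Finite (M.map (QuotientGroup.mk' Z)))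
    (hMN : ⁅M, N⁆ = ⊥) [N.FiniteIndex] : {x | ∃ m ∈ M, ∃ e : E, ⁅m, e⁆ = x}.Finite := by
  have : Finite (E ⧸ N) := N.finite_quotient_of_finiteIndex
  -- The commutator `[m, e]` depends only on `m` modulo `Z` and `e` modulo `N`.
  refine (Set.finite_range fun p : M.map (QuotientGroup.mk' Z) × (E ⧸ N) =>
    ⁅(p.1 : E ⧸ Z).out, p.2.out⁆).subset ?_
  rintro _ ⟨m, hm, e, rfl⟩
  refine ⟨(⟨QuotientGroup.mk' Z m, m, hm, rfl⟩, (e : E ⧸ N)), ?_⟩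
  change ⁅(m : E ⧸ Z).out, (e : E ⧸ N).out⁆ = _
  obtain ⟨z, hz⟩ := QuotientGroup.mk_out_eq_mul Z m
  obtain ⟨n, hn⟩ := QuotientGroup.mk_out_eq_mul N e
  have hzc : ∀ g, Commute g (z : E) := fun g => Subgroup.mem_center_iff.1 (hZ z.2) g
  have hmn : Commute m (n : E) := by
    rw [← commutatorElement_eq_one_iff_commute, ← Subgroup.mem_bot, ← hMN]
    exact Subgroup.commutator_mem_commutator hm n.2
  rw [hz, hn]
  calc ⁅m * (z : E), e * n⁆ = m * ((z : E) * (e * n)) * (z : E)⁻¹ * m⁻¹ * (e * n)⁻¹ := by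
        rw [commutatorElement_def]; group
    _ = m * e * ((n : E) * m⁻¹) * (n : E)⁻¹ * e⁻¹ := by rw [← (hzc _).eq]; group
    _ = ⁅m, e⁆ := by rw [← hmn.inv_left.eq, commutatorElement_def]; group

/-- Schur's theorem: the center of `M` has finite index, so `M` has only finitely many commutators.
-/
theorem finite_commutator_of_finite_map {E : Type*} [Group E] (M Z : Subgroup E) [Z.Normal]
    (hZ : Z ≤ Subgroup.center E) (hMZ : Finite (M.map (QuotientGroup.mk' Z))) :
    Finite (commutator M) := by
  have hZc : Z.subgroupOf M ≤ Subgroup.center M := fun x hx =>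
    Subgroup.mem_center_iff.2 fun g => Subtype.ext (Subgroup.mem_center_iff.1 (hZ hx) g)
  have hfi : (Z.subgroupOf M).FiniteIndex := by
    have : Finite ((QuotientGroup.mk' Z).subgroupMap M).range := inferInstance
    have h := Subgroup.finiteIndex_ker ((QuotientGroup.mk' Z).subgroupMap M)
    convert h using 1
    ext x
    rw [MonoidHom.mem_ker, ← Subtype.coe_inj]
    exact (QuotientGroup.eq_one_iff (x : E)).symm
  have : (Subgroup.center M).FiniteIndex := Subgroup.finiteIndex_of_le hZc
  have : Finite (M ⧸ Subgroup.center M) := Subgroup.finite_quotient_of_finiteIndex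
  have h := finite_commutatorElement_set (⊤ : Subgroup M) (Subgroup.center M) (Subgroup.center M)
    le_rfl inferInstance
    (by rw [Subgroup.commutator_eq_bot_iff_le_centralizer]; simp)
  have : Finite (commutatorSet M) := by
    refine Set.Finite.subset h ?_
    rintro _ ⟨a, b, rfl⟩
    exact ⟨a, trivial, b, rfl⟩
  infer_instance

/-- The abelianization is finitely generated and torsion, hence finite. -/
theorem finite_of_finite_commutator_of_closure {G : Type*} [Group G] [Finite (commutator G)]
    (S : Set G) (hS : S.Finite) (hcl : Subgroup.closure S = ⊤) (ht : ∀ s ∈ S, IsOfFinOrder s) :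
    Finite G := by
  have : Group.FG G := ⟨hS.toFinset, by simpa using hcl⟩
  have htor : IsMulTorsion (Abelianization G) := by
    have h : Subgroup.closure (Abelianization.of '' S) ≤ CommGroup.torsion (Abelianization G) := by
      rw [Subgroup.closure_le]
      rintro _ ⟨s, hs, rfl⟩
      exact MonoidHom.isOfFinOrder _ (ht s hs)
    rw [← MonoidHom.map_closure, hcl] at h
    intro x
    obtain ⟨y, rfl⟩ := QuotientGroup.mk_surjective x
    exact h ⟨y, trivial, rfl⟩
  have : Group.FG (Abelianization G) :=
    Group.fg_of_surjective (f := Abelianization.of) QuotientGroup.mk_surjective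
  have : Finite (G ⧸ commutator G) := CommGroup.finite_of_fg_isMulTorsion (Abelianization G) htor
  exact Finite.of_subgroup_quotient (commutator G)

theorem isOfFinOrder_commutatorElement {E : Type*} [Group E] (M Z : Subgroup E) [M.Normal]
    [Z.Normal] (hZ : Z ≤ Subgroup.center E) (hMZ : Finite (M.map (QuotientGroup.mk' Z)))
    {m : E} (hm : m ∈ M) (e : E) : IsOfFinOrder ⁅m, e⁆ := by
  have := finite_commutator_of_finite_map M Z hZ hMZ
  obtain ⟨n, hn, hmn⟩ : ∃ n, 0 < n ∧ m ^ n ∈ Z := by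
    obtain ⟨n, hn, h⟩ := (isOfFinOrder_of_finite
      (⟨QuotientGroup.mk' Z m, m, hm, rfl⟩ : M.map (QuotientGroup.mk' Z))).exists_pow_eq_one
    exact ⟨n, hn, (QuotientGroup.eq_one_iff _).1 (congrArg Subtype.val h)⟩
  -- Here `a * b = [m, e]`, and `a ^ n * b ^ n = 1` because `m ^ n` is central. Hence `(a * b) ^ n`
  -- dies in the abelianization of `M`, so it lies in the finite derived subgroup.
  let a : M := ⟨m, hm⟩
  let b : M := ⟨e * m⁻¹ * e⁻¹, Subgroup.Normal.conj_mem ‹_› _ (inv_mem hm) e⟩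
  have hab : a ^ n * b ^ n = 1 := by
    refine Subtype.ext ?_
    have := Subgroup.mem_center_iff.1 (hZ hmn) e
    simp only [a, b, Subgroup.coe_mul, Subgroup.coe_pow, conj_pow, inv_pow, Subgroup.coe_one]
    rw [← mul_assoc, ← mul_assoc, ← this]
    group
  have hc : (a * b) ^ n ∈ commutator M := by
    rw [← Abelianization.ker_of, MonoidHom.mem_ker, map_pow, map_mul, mul_pow, ← map_pow,
      ← map_pow, ← map_mul, hab, map_one]
  have h : IsOfFinOrder ((⟨_, hc⟩ : commutator M)) := isOfFinOrder_of_finite _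
  have h' := M.subtype.isOfFinOrder
    (((commutator M).subtype.isOfFinOrder h).of_pow (a := a * b) hn.ne')
  convert h' using 1
  simp [a, b, commutatorElement_def, mul_assoc]

/-- `[M, E]` is generated by finitely many commutators of finite order, and its derived subgroup is
finite by Schur's theorem. -/
theorem finite_commutator_top {E : Type*} [Group E] (M Z N : Subgroup E) [M.Normal] [Z.Normal]
    (hZ : Z ≤ Subgroup.center E) (hMZ : Finite (M.map (QuotientGroup.mk' Z)))
    (hMN : ⁅M, N⁆ = ⊥) [N.FiniteIndex] : Finite (⁅M, ⊤⁆ : Subgroup E) := by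
  have hX := finite_commutatorElement_set M Z N hZ hMZ hMN
  have hle : ⁅M, (⊤ : Subgroup E)⁆ ≤ M := Subgroup.commutator_le_left _ _
  have : Finite ((⁅M, (⊤ : Subgroup E)⁆).map (QuotientGroup.mk' Z)) :=
    Finite.Set.subset (M.map (QuotientGroup.mk' Z) : Set (E ⧸ Z)) (Subgroup.map_mono hle)
  have := finite_commutator_of_finite_map ⁅M, (⊤ : Subgroup E)⁆ Z hZ this
  refine finite_of_finite_commutator_of_closure
    (Subtype.val ⁻¹' {x | ∃ m ∈ M, ∃ e : E, ⁅m, e⁆ = x})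
    (hX.preimage Subtype.val_injective.injOn) ?_ ?_
  · have := Subgroup.closure_closure_coe_preimage (k := {x | ∃ m ∈ M, ∃ e : E, ⁅m, e⁆ = x})
    have e : ⁅M, (⊤ : Subgroup E)⁆ = Subgroup.closure {x | ∃ m ∈ M, ∃ e : E, ⁅m, e⁆ = x} := by
      rw [Subgroup.commutator_def]; simp
    rw [e]; exact this
  · rintro ⟨x, hx⟩ ⟨m, hm, e, rfl⟩
    exact Submonoid.isOfFinOrder_coe.1 (isOfFinOrder_commutatorElement M Z hZ hMZ hm e)

/-- **Baer's theorem**: if `N` is a normal subgroup of finite index with `[N, _c E] = 1`, then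
`γ_{c+1}(E)` is finite. -/
theorem finite_lowerCentralSeries_of_iterComm_eq_bot (c : ℕ) :
    ∀ {E : Type*} [Group E] (N : Subgroup E) (_ : N.Normal) [N.FiniteIndex]
      (_ : iterComm N c = ⊥), Finite ((⊤ : Subgroup E).lowerCentralSeries c) := by
  induction c with
  | zero =>
    intro E _ N _ _ h
    have h : N = ⊥ := h
    subst h
    have : Finite E := Nat.finite_of_card_ne_zero
      (Subgroup.index_bot (G := E) ▸ Subgroup.FiniteIndex.index_ne_zero)
    infer_instance
  | succ c ih =>
    intro E _ N hN _ h
    have hnorm := iterComm_normal N hN c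
    have hcen : iterComm N c ≤ Subgroup.center E := by
      have := Subgroup.commutator_eq_bot_iff_le_centralizer.1 h
      simpa [Subgroup.centralizer_univ] using this
    let q := QuotientGroup.mk' (iterComm N c)
    have hq : Function.Surjective q := QuotientGroup.mk'_surjective _
    have : (N.map q).FiniteIndex := ⟨fun h0 => Subgroup.FiniteIndex.index_ne_zero (H := N)
      (Nat.eq_zero_of_zero_dvd (h0 ▸ Subgroup.index_map_dvd N hq))⟩
    -- The induction hypothesis in `E / [N, _c E]` makes `γ_{c+1}(E)` finite modulo a central
    -- subgroup, while `N` centralizes it since `[N, γ_{c+1}(E)] ≤ [N, _{c+1} E] = 1`.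
    have hfin := ih (N.map q) (hN.map q hq)
      (by rw [iterComm_map_eq q hq, Subgroup.map_eq_bot_iff, QuotientGroup.ker_mk'])
    rw [← lowerCentralSeries_top_map_eq q hq] at hfin
    refine finite_commutator_top _ (iterComm N c) N hcen hfin ?_
    rw [Subgroup.commutator_comm, eq_bot_iff, ← h]
    exact (commutator_iterComm_lowerCentralSeries_le N hN c 0).trans_eq (by rw [zero_add])

/-- The quotient embeds in `γ_{c+1}(E / [N, _c E])`, which Baer's theorem makes finite. -/
theorem GammaQuotient.finite {E : Type*} [Group E] (c : ℕ) (N : Subgroup E) (hN : N.Normal)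
    [N.FiniteIndex] : Finite (GammaQuotient c N hN) := by
  have hnorm := iterComm_normal N hN c
  let q := QuotientGroup.mk' (iterComm N c)
  have hq : Function.Surjective q := QuotientGroup.mk'_surjective _
  have : (N.map q).FiniteIndex := ⟨fun h0 => Subgroup.FiniteIndex.index_ne_zero (H := N)
    (Nat.eq_zero_of_zero_dvd (h0 ▸ Subgroup.index_map_dvd N hq))⟩
  have hfin := finite_lowerCentralSeries_of_iterComm_eq_bot c (N.map q) (hN.map q hq)
    (by rw [iterComm_map_eq q hq, Subgroup.map_eq_bot_iff, QuotientGroup.ker_mk'])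
  let f : ↥(N ⊓ (⊤ : Subgroup E).lowerCentralSeries c) →* (⊤ : Subgroup _).lowerCentralSeries c :=
    (q.comp (Subgroup.subtype _)).codRestrict _
      fun x => lowerCentralSeries_top_map_le q c ⟨x, x.2.2, rfl⟩
  have h : f.ker = (iterComm N c).subgroupOf _ := by
    ext x
    rw [MonoidHom.mem_ker, ← Subtype.coe_inj]
    exact QuotientGroup.eq_one_iff (x : E)
  have := Subgroup.finiteIndex_ker f
  rw [h] at this
  exact Subgroup.finite_quotient_of_finiteIndex

/-- A quotient of a finite abelian group is isomorphic to a subgroup. -/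
theorem CommGroup.exists_subgroup_mulEquiv_of_surjective {G H : Type*} [CommGroup G] [CommGroup H]
    [Finite G] (f : G →* H) (hf : Function.Surjective f) :
    ∃ L : Subgroup G, Nonempty (L ≃* H) := by
  have : Finite H := Finite.of_surjective f hf
  -- A finite abelian group is isomorphic to its character group, and passing to characters turns
  -- the surjection into an injection.
  obtain ⟨eG⟩ := CommGroup.monoidHom_mulEquiv_of_hasEnoughRootsOfUnity G ℂ
  obtain ⟨eH⟩ := CommGroup.monoidHom_mulEquiv_of_hasEnoughRootsOfUnity H ℂ
  let d : (H →* ℂˣ) →* (G →* ℂˣ) := MonoidHom.compHom' f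
  have hd : Function.Injective d := fun a b h => by
    ext x
    obtain ⟨y, rfl⟩ := hf x
    exact congrArg Units.val (DFunLike.congr_fun h y)
  let i : H →* G := (eG.toMonoidHom.comp d).comp eH.symm.toMonoidHom
  have hi : Function.Injective i := eG.injective.comp (hd.comp eH.symm.injective)
  exact ⟨i.range, ⟨(MonoidHom.ofInjective hi).symm⟩⟩

/-! ### Verbal and mutual commutator subgroups under homomorphisms -/

theorem verbalSubgroup_map_eq (V : Set (FreeGroup ℕ)) {G H : Type*} [Group G] [Group H]
    (f : G →* H) (hf : Function.Surjective f) :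
    (verbalSubgroup V G).map f = verbalSubgroup V H := by
  refine le_antisymm (verbalSubgroup_map_le V f) ?_
  rw [verbalSubgroup, verbalSubgroup, MonoidHom.map_closure, Subgroup.closure_le]
  rintro _ ⟨v, hv, g, rfl⟩
  choose g' hg' using fun n => hf (g n)
  refine Subgroup.subset_closure ⟨_, ⟨v, hv, g', rfl⟩, ?_⟩
  have h : FreeGroup.lift g = f.comp (FreeGroup.lift g') := by
    ext n; simp [hg']
  rw [h]; rfl

theorem normalClosure_map_le_of_hom {G H : Type*} [Group G] [Group H] (f : G →* H)
    {S : Subgroup G} {T : Subgroup H} (h : S.map f ≤ T) :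
    (Subgroup.normalClosure (S : Set G)).map f ≤ Subgroup.normalClosure (T : Set H) := by
  rw [Subgroup.map_le_iff_le_comap]
  exact Subgroup.normalClosure_le_normal
    fun x hx => Subgroup.subset_normalClosure (h ⟨x, hx, rfl⟩)

theorem mutualCommutator_map_le_of_hom {G H ι κ : Type*} [Group G] [Group H] (f : G →* H)
    {r : ι → ι → Prop} {s : κ → κ → Prop} {S : ι → Subgroup G} {T : κ → Subgroup H} (p : ι → κ)
    (hp : ∀ i j, r i j → s (p i) (p j)) (h : ∀ i, (S i).map f ≤ T (p i)) :
    (mutualCommutator r S).map f ≤ mutualCommutator s T := by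
  simp only [mutualCommutator, Subgroup.map_iSup, Subgroup.map_commutator]
  refine iSup_le fun i => iSup_le fun j => iSup_le fun hij => ?_
  refine (Subgroup.commutator_mono (normalClosure_map_le_of_hom f (h i))
    (normalClosure_map_le_of_hom f (h j))).trans ?_
  exact le_iSup_of_le (p i) (le_iSup_of_le (p j) (le_iSup_of_le (hp i j hij) le_rfl))

/-! ### Free products of copies and lifting of `C_V` -/

section Copies

variable {A B F : Type*} [Group A] [Group F]

/-- The homomorphism of free products of copies induced by a homomorphism of the factors. -/
def copiesMap (B : Type*) (ν : F →* A) : CopiesProd F B →* CopiesProd A B :=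
  CoprodI.lift fun b => (CoprodI.of (M := fun _ : B => A) (i := b)).comp ν

theorem copiesMap_of (ν : F →* A) (b : B) (f : F) :
    copiesMap B ν (CoprodI.of (i := b) f) = CoprodI.of (M := fun _ : B => A) (i := b) (ν f) := by
  simp [copiesMap]

theorem copiesMap_surjective (ν : F →* A) (hν : Function.Surjective ν) :
    Function.Surjective (copiesMap B ν) := by
  intro x
  induction x using CoprodI.induction_on with
  | one => exact ⟨1, map_one _⟩
  | of b a =>
    obtain ⟨f, rfl⟩ := hν a
    exact ⟨_, copiesMap_of ν b f⟩
  | mul x y hx hy =>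
    obtain ⟨u, rfl⟩ := hx
    obtain ⟨v, rfl⟩ := hy
    exact ⟨u * v, map_mul _ _ _⟩

open Classical in
/-- The component at `b` of an element of the free product of copies. -/
noncomputable def copiesComponent (A : Type*) [Group A] (b : B) : CopiesProd A B →* A :=
  CoprodI.lift fun i => if i = b then MonoidHom.id A else 1

theorem copiesComponent_of_self (b : B) (a : A) :
    copiesComponent A b (CoprodI.of (M := fun _ : B => A) (i := b) a) = a := by
  simp [copiesComponent]

theorem copiesComponent_of_ne {b i : B} (h : i ≠ b) (a : A) :
    copiesComponent A b (CoprodI.of (M := fun _ : B => A) (i := i) a) = 1 := by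
  simp [copiesComponent, h]

theorem copiesComponent_copiesMap (ν : F →* A) (b : B) (x : CopiesProd F B) :
    copiesComponent A b (copiesMap B ν x) = ν (copiesComponent F b x) := by
  suffices h : (copiesComponent A b).comp (copiesMap B ν) = ν.comp (copiesComponent F b) from
    DFunLike.congr_fun h x
  refine CoprodI.ext_hom _ _ fun i => MonoidHom.ext fun f => ?_
  by_cases h : i = b
  · subst h
    simp [copiesMap_of, copiesComponent_of_self]
  · simp [copiesMap_of, copiesComponent_of_ne h]

instance copiesCartesian_normal : (copiesCartesian A B).Normal :=
  mutualCommutator_normal _ _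

theorem copiesCartesian_le_ker_copiesComponent (b : B) :
    copiesCartesian A B ≤ (copiesComponent A b).ker := by
  have key : ∀ i, i ≠ b → Subgroup.normalClosure
      ((CoprodI.of (M := fun _ : B => A) (i := i)).range : Set (CopiesProd A B)) ≤
        (copiesComponent A b).ker := fun i hi =>
    Subgroup.normalClosure_le_normal (by rintro _ ⟨a, rfl⟩; exact copiesComponent_of_ne hi a)
  refine iSup_le fun i => iSup_le fun j => iSup_le fun hij => ?_
  by_cases hi : i = b
  · exact (Subgroup.commutator_le_right _ _).trans (key j fun hj => hij (hi.trans hj.symm))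
  · exact (Subgroup.commutator_le_left _ _).trans (key i hi)

theorem commute_mk_copiesCartesian {i j : B} (h : i ≠ j) (a a' : A) :
    Commute (QuotientGroup.mk' (copiesCartesian A B) (CoprodI.of (i := i) a))
      (QuotientGroup.mk' (copiesCartesian A B) (CoprodI.of (i := j) a')) := by
  rw [← commutatorElement_eq_one_iff_commute, ← map_commutatorElement]
  refine (QuotientGroup.eq_one_iff _).2 ?_
  refine (le_iSup_of_le i (le_iSup_of_le j (le_iSup_of_le h le_rfl)) : _ ≤ copiesCartesian A B)
    (Subgroup.commutator_mem_commutator ?_ ?_)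
  · exact Subgroup.subset_normalClosure ⟨a, rfl⟩
  · exact Subgroup.subset_normalClosure ⟨a', rfl⟩

theorem pairwise_commute_mk_copiesCartesian (t : Set B) (g : B → A) :
    t.Pairwise (Function.onFun Commute fun b => QuotientGroup.mk' (copiesCartesian A B)
      (CoprodI.of (M := fun _ : B => A) (i := b) (g b))) :=
  fun _ _ _ _ h => commute_mk_copiesCartesian h _ _

/-- Modulo the cartesian subgroup, every element is the product of its components. -/
theorem exists_mk_eq_noncommProd_component (y : CopiesProd A B) :
    ∃ s : Finset B, ∀ t : Finset B, s ⊆ t → QuotientGroup.mk' (copiesCartesian A B) y =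
      t.noncommProd (fun b => QuotientGroup.mk' (copiesCartesian A B)
        (CoprodI.of (M := fun _ : B => A) (i := b) (copiesComponent A b y)))
        (pairwise_commute_mk_copiesCartesian t fun b => copiesComponent A b y) := by
  classical
  induction y using CoprodI.induction_on with
  | one =>
    refine ⟨∅, fun t _ => ?_⟩
    rw [Finset.noncommProd_eq_pow_card (m := 1)] <;> simp
  | of i a =>
    refine ⟨{i}, fun t ht => ?_⟩
    rw [← Finset.mul_noncommProd_erase t (ht (Finset.mem_singleton_self i)),
      copiesComponent_of_self]
    refine (mul_eq_left.2 ((Finset.noncommProd_eq_pow_card _ _ _ 1 fun b hb => ?_).trans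
      (one_pow _))).symm
    rw [copiesComponent_of_ne (Finset.ne_of_mem_erase hb).symm, map_one, map_one]
  | mul x y hx hy =>
    obtain ⟨s, hs⟩ := hx
    obtain ⟨s', hs'⟩ := hy
    -- Allowing every `t ⊇ s` lets both factors be expanded over the same finite set.
    refine ⟨s ∪ s', fun t ht => ?_⟩
    rw [map_mul, hs t (Finset.union_subset_left ht), hs' t (Finset.union_subset_right ht),
      ← Finset.noncommProd_mul_distrib]
    · exact Finset.noncommProd_congr rfl (fun b _ => by simp) _
    · exact fun _ _ _ _ h => commute_mk_copiesCartesian h _ _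

/-- A verbal lift `y` of `x` need not be in the cartesian subgroup. Modulo that subgroup `y` is the
product of its components, which are verbal and map to components of `x`, hence to `1`. Dividing `y`
by a suitable `d ∈ D` repairs it without changing its image. -/
theorem exists_mem_copiesVerbal_copiesMap_eq (V : Set (FreeGroup ℕ)) (ν : F →* A)
    (hν : Function.Surjective ν) {x : CopiesProd A B} (hx : x ∈ copiesVerbal V A B) :
    ∃ y ∈ copiesVerbal V F B, copiesMap B ν y = x := by
  obtain ⟨y, hy, rfl⟩ : x ∈ (verbalSubgroup V (CopiesProd F B)).map (copiesMap B ν) := by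
    rw [verbalSubgroup_map_eq V _ (copiesMap_surjective ν hν)]
    exact hx.1
  let D := verbalSubgroup V (CopiesProd F B) ⊓ (copiesMap B ν).ker
  have hD : ∀ b, CoprodI.of (M := fun _ : B => F) (i := b) (copiesComponent F b y) ∈ D := by
    refine fun b => Subgroup.mem_inf.2
      ⟨verbalSubgroup_map_le V _ ⟨_, verbalSubgroup_map_le V _ ⟨y, hy, rfl⟩, rfl⟩, ?_⟩
    rw [MonoidHom.mem_ker, copiesMap_of, ← copiesComponent_copiesMap,
      MonoidHom.mem_ker.1 (copiesCartesian_le_ker_copiesComponent b hx.2), map_one]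
  obtain ⟨s, hs⟩ := exists_mk_eq_noncommProd_component y
  obtain ⟨d, hd, hdy⟩ : QuotientGroup.mk' (copiesCartesian F B) y ∈
      D.map (QuotientGroup.mk' (copiesCartesian F B)) := by
    rw [hs s subset_rfl]
    exact Subgroup.noncommProd_mem _ _ fun b _ => ⟨_, hD b, rfl⟩
  obtain ⟨hd₁, hd₂⟩ := Subgroup.mem_inf.1 (show d ∈ D from hd)
  refine ⟨d⁻¹ * y, Subgroup.mem_inf.2 ⟨mul_mem (inv_mem hd₁) hy, QuotientGroup.eq.1 hdy⟩, ?_⟩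
  rw [map_mul, map_inv, MonoidHom.mem_ker.1 hd₂, inv_one, one_mul]

end Copies

/-! ### The kernel of `K → A Wr_V B` -/

section Wreath

variable (V : Set (FreeGroup ℕ)) {A B F₁ F₂ : Type*} [Group A] [Group B] [Group F₁] [Group F₂]
  (ν₁ : F₁ →* A) (ν₂ : F₂ →* B)

variable (A B) in
/-- The left action of `B` on the free product of copies, with exponent `b⁻¹`. -/
def copiesAction : B →* MulAut (CopiesProd A B) where
  toFun b := copiesShift A B b⁻¹
  map_one' := MulEquiv.ext fun x => by
    rw [inv_one]
    exact DFunLike.congr_fun (copiesShiftHom_one A B) x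
  map_mul' b b' := MulEquiv.ext fun x => by
    rw [mul_inv_rev]
    exact (DFunLike.congr_fun (copiesShiftHom_comp A B b⁻¹ b'⁻¹) x).symm

theorem copiesAction_of (b x : B) (a : A) :
    copiesAction A B b (CoprodI.of (M := fun _ : B => A) (i := x) a) =
      CoprodI.of (M := fun _ : B => A) (i := x * b⁻¹) a := by
  simp [copiesAction, copiesShift, copiesShiftHom]

/-- The projection of the semidirect product of `C` by `B` onto the verbal wreath product. -/
def toVerbalWreath : CopiesProd A B ⋊[copiesAction A B] B →* VerbalWreath V A B :=
  SemidirectProduct.map (QuotientGroup.mk' (copiesVerbal V A B)) (MonoidHom.id B)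
    fun _ => MonoidHom.ext fun _ => rfl

theorem toVerbalWreath_inl (x : CopiesProd A B) :
    toVerbalWreath V (SemidirectProduct.inl x) =
      SemidirectProduct.inl (QuotientGroup.mk' (copiesVerbal V A B) x) :=
  SemidirectProduct.map_inl _ _ _ x

theorem toVerbalWreath_inr (b : B) :
    toVerbalWreath V (A := A) (SemidirectProduct.inr b) = SemidirectProduct.inr b :=
  SemidirectProduct.map_inr _ _ _ b

/-- The homomorphism of `F₁ * F₂` to the semidirect product of `C` by `B`. -/
def coprodToCopies : Coprod F₁ F₂ →* CopiesProd A B ⋊[copiesAction A B] B :=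
  Coprod.lift ((SemidirectProduct.inl.comp
    (CoprodI.of (M := fun _ : B => A) (i := 1))).comp ν₁) (SemidirectProduct.inr.comp ν₂)

/-- The homomorphism `K = F₁ * B → A Wr_V B`. -/
def coprodToWreath : Coprod F₁ B →* VerbalWreath V A B :=
  (toVerbalWreath V).comp (coprodToCopies ν₁ (MonoidHom.id B))

theorem coprodToWreath_inl (f : F₁) : coprodToWreath V ν₁ (B := B) (Coprod.inl f) =
    SemidirectProduct.inl (QuotientGroup.mk' (copiesVerbal V A B)
      (CoprodI.of (M := fun _ : B => A) (i := 1) (ν₁ f))) := by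
  simp [coprodToWreath, coprodToCopies, toVerbalWreath_inl]

theorem coprodToWreath_inr (b : B) :
    coprodToWreath V ν₁ (Coprod.inr b) = SemidirectProduct.inr b := by
  simp [coprodToWreath, coprodToCopies, toVerbalWreath_inr]

theorem coprodToWreath_comp_deltaHom : (coprodToWreath V ν₁).comp (deltaHom F₁ ν₂) =
    (toVerbalWreath V).comp (coprodToCopies ν₁ ν₂) := by
  refine Coprod.hom_ext ?_ ?_ <;> ext x <;>
    simp [coprodToWreath, deltaHom, coprodToCopies]

theorem coprodToWreath_surjective (hν₁ : Function.Surjective ν₁) :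
    Function.Surjective (coprodToWreath V ν₁ (B := B)) := by
  rw [← MonoidHom.range_eq_top, eq_top_iff]
  have hr : ∀ b, (SemidirectProduct.inr b : VerbalWreath V A B) ∈
      (coprodToWreath V ν₁ (B := B)).range := fun b => ⟨_, coprodToWreath_inr V ν₁ b⟩
  have hl : ∀ x : CopiesProd A B, (SemidirectProduct.inl (QuotientGroup.mk' (copiesVerbal V A B) x) :
      VerbalWreath V A B) ∈ (coprodToWreath V ν₁ (B := B)).range := by
    intro x
    induction x using CoprodI.induction_on with
    | one => rw [map_one, map_one]; exact one_mem _
    | of b a =>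
      obtain ⟨f, rfl⟩ := hν₁ a
      have h : QuotientGroup.mk' (copiesVerbal V A B)
          (CoprodI.of (M := fun _ : B => A) (i := b) (ν₁ f)) =
          verbalAction V A B b⁻¹ (QuotientGroup.mk' (copiesVerbal V A B)
            (CoprodI.of (M := fun _ : B => A) (i := 1) (ν₁ f))) := by
        have := copiesAction_of (A := A) b⁻¹ 1 (ν₁ f)
        rw [inv_inv, one_mul] at this
        rw [← this]
        rfl
      rw [h, SemidirectProduct.inl_aut]
      exact mul_mem (mul_mem (hr _) ⟨_, coprodToWreath_inl V ν₁ f⟩) (hr _)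
    | mul x y hx hy => rw [map_mul, map_mul]; exact mul_mem hx hy
  intro w _
  rw [← SemidirectProduct.inl_left_mul_inr_right w]
  obtain ⟨x, hx⟩ := QuotientGroup.mk'_surjective _ w.left
  rw [← hx]
  exact mul_mem (hl x) (hr _)

theorem right_coprodToCopies_of_mem_freeBase {x : Coprod F₁ F₂} (hx : x ∈ freeBase F₁ F₂) :
    (coprodToCopies ν₁ ν₂ x).right = 1 := by
  have h : freeBase F₁ F₂ ≤ (SemidirectProduct.rightHom.comp (coprodToCopies ν₁ ν₂)).ker := by
    refine Subgroup.normalClosure_le_normal ?_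
    rintro _ ⟨f, rfl⟩
    simp [coprodToCopies]
  exact h hx

/-- The homomorphism `H = F₁^F → C`. -/
def freeBaseToCopies : freeBase F₁ F₂ →* CopiesProd A B :=
  MonoidHom.mk' (fun x => (coprodToCopies ν₁ ν₂ x).left) fun x y => by
    rw [Subgroup.coe_mul, map_mul, SemidirectProduct.mul_left,
      right_coprodToCopies_of_mem_freeBase ν₁ ν₂ x.2, map_one, MulAut.one_apply]

theorem coprodToCopies_coe (x : freeBase F₁ F₂) :
    coprodToCopies ν₁ ν₂ x = SemidirectProduct.inl (freeBaseToCopies ν₁ ν₂ x) :=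
  SemidirectProduct.ext rfl (right_coprodToCopies_of_mem_freeBase ν₁ ν₂ x.2)

/-- The conjugate `F₁^u` lands in the copy indexed by `ν₂ u`, so the condition `ν₂ u ≠ ν₂ v` becomes
distinctness of copies. -/
theorem verbalRelInner_map_freeBaseToCopies_le :
    (verbalRelInner V (F₁ := F₁) ν₂).map (freeBaseToCopies ν₁ ν₂) ≤ copiesVerbal V A B := by
  refine (Subgroup.map_inf_le _ _ _).trans (inf_le_inf (verbalSubgroup_map_le V _) ?_)
  refine mutualCommutator_map_le_of_hom _ ν₂ (fun _ _ h => h) fun u => ?_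
  rintro _ ⟨x, ⟨_, ⟨f, rfl⟩, hx⟩, rfl⟩
  refine ⟨ν₁ f, SemidirectProduct.inl_injective (φ := copiesAction A B) ?_⟩
  rw [← coprodToCopies_coe]
  have h : (Coprod.inr u)⁻¹ * Coprod.inl f * Coprod.inr u = (x : Coprod F₁ F₂) := by
    simpa using hx
  have h' := copiesAction_of (ν₂ u)⁻¹ 1 (ν₁ f)
  rw [inv_inv, one_mul] at h'
  rw [← h, ← h', SemidirectProduct.inl_aut]
  simp [coprodToCopies]

theorem verbalS_le_ker :
    verbalS V ν₁ ν₂ ≤ ((coprodToWreath V ν₁).comp (deltaHom F₁ ν₂)).ker := by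
  refine sup_le (sup_le ?_ ?_) ?_
  · refine Subgroup.normalClosure_le_normal ?_
    rw [SetLike.coe_subset_coe, Subgroup.commutator_le]
    rintro _ ⟨r, hr, rfl⟩ _ ⟨f, rfl⟩
    have hr : ν₂ r = 1 := hr
    rw [MonoidHom.mem_ker, map_commutatorElement]
    simp [deltaHom, hr]
  · refine Subgroup.normalClosure_le_normal ?_
    rintro _ ⟨r, hr, rfl⟩
    have hr : ν₁ r = 1 := hr
    simp [deltaHom, coprodToWreath_inl, hr]
  · rintro _ ⟨x, hx, rfl⟩
    rw [coprodToWreath_comp_deltaHom, MonoidHom.mem_ker, MonoidHom.comp_apply,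
      Subgroup.subtype_apply, coprodToCopies_coe, toVerbalWreath_inl,
      MonoidHom.mem_ker.1 ((QuotientGroup.ker_mk' (copiesVerbal V A B)).ge
        (verbalRelInner_map_freeBaseToCopies_le V ν₁ ν₂ ⟨x, hx, rfl⟩)), map_one]

/-- For a map `s : B → F₂`, the homomorphism `f_b ↦ s(b)⁻¹ f s(b)` from the free product of copies
of `F₁` to `F₁^F`. -/
def copiesToFreeBase (s : B → F₂) : CopiesProd F₁ B →* freeBase F₁ F₂ :=
  CoprodI.lift fun b => ((MulAut.conj (Coprod.inr (s b))⁻¹).toMonoidHom.comp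
    Coprod.inl).codRestrict (freeBase F₁ F₂) fun f => (freeBase_normal (F₁ := F₁)).conj_mem
      (Coprod.inl f) (Subgroup.subset_normalClosure ⟨f, rfl⟩) (Coprod.inr (s b))⁻¹

theorem coe_copiesToFreeBase_of (s : B → F₂) (b : B) (f : F₁) :
    (copiesToFreeBase s (CoprodI.of (M := fun _ : B => F₁) (i := b) f) : Coprod F₁ F₂) =
      (Coprod.inr (s b))⁻¹ * Coprod.inl f * Coprod.inr (s b) := by
  simp [copiesToFreeBase]

theorem copiesVerbal_map_copiesToFreeBase_le (s : B → F₂) (hs : ∀ b, ν₂ (s b) = b) :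
    (copiesVerbal V F₁ B).map (copiesToFreeBase s) ≤ verbalRelInner V ν₂ := by
  refine (Subgroup.map_inf_le _ _ _).trans (inf_le_inf (verbalSubgroup_map_le V _) ?_)
  refine mutualCommutator_map_le_of_hom _ s (fun i j h => by simpa [hs] using h) fun b => ?_
  rintro _ ⟨_, ⟨f, rfl⟩, rfl⟩
  refine ⟨_, ⟨f, rfl⟩, ?_⟩
  change _ = ((copiesToFreeBase s _ : freeBase F₁ F₂) : Coprod F₁ F₂)
  rw [coe_copiesToFreeBase_of]
  simp

/-- The kernel of `K → A Wr_V B` is `T_V`. -/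
theorem ker_coprodToWreath (hν₁ : Function.Surjective ν₁) (hν₂ : Function.Surjective ν₂) :
    (coprodToWreath V ν₁).ker = verbalT V ν₁ ν₂ := by
  refine le_antisymm ?_ ?_
  swap
  · rw [verbalT, Subgroup.map_le_iff_le_comap]
    exact verbalS_le_ker V ν₁ ν₂
  have hT := verbalT_normal V ν₁ ν₂ hν₂
  let q := QuotientGroup.mk' (verbalT V ν₁ ν₂)
  choose s hs using hν₂
  have hST : ∀ x ∈ verbalS V ν₁ ν₂, q (deltaHom F₁ ν₂ x) = 1 := fun x hx =>
    (QuotientGroup.eq_one_iff _).2 ⟨x, hx, rfl⟩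
  have hker : ν₁.ker ≤ (q.comp (Coprod.inl : F₁ →* Coprod F₁ B)).ker := by
    intro r hr
    have := hST (Coprod.inl r) (Subgroup.mem_sup_left (Subgroup.mem_sup_right
      (Subgroup.subset_normalClosure ⟨r, hr, rfl⟩)))
    simpa [deltaHom] using this
  -- From here a map `ψ` from the wreath product back to `K / T_V` is built with `ψ ∘ (K → A Wr_V B)
  -- = q`; this forces the kernel into `T_V`.
  let a : A →* Coprod F₁ B ⧸ verbalT V ν₁ ν₂ := ν₁.liftOfSurjective hν₁ ⟨_, hker⟩
  have ha : ∀ f, a (ν₁ f) = q (Coprod.inl f) := fun f =>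
    ν₁.liftOfRightInverse_comp_apply _ _ ⟨_, hker⟩ f
  let j : CopiesProd A B →* Coprod F₁ B ⧸ verbalT V ν₁ ν₂ :=
    CoprodI.lift fun b => (MulAut.conj (q (Coprod.inr b))⁻¹).toMonoidHom.comp a
  have hj : ∀ b x, j (CoprodI.of (M := fun _ : B => A) (i := b) x) =
      (q (Coprod.inr b))⁻¹ * a x * q (Coprod.inr b) := fun b x => by
    simp [j]
  have hjμ : j.comp (copiesMap B ν₁) =
      ((q.comp (deltaHom F₁ ν₂)).comp (freeBase F₁ F₂).subtype).comp (copiesToFreeBase s) := by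
    refine CoprodI.ext_hom _ _ fun b => MonoidHom.ext fun f => ?_
    simp only [MonoidHom.comp_apply, copiesMap_of, Subgroup.subtype_apply,
      coe_copiesToFreeBase_of, hj, ha, map_mul, map_inv]
    simp [deltaHom, hs]
  -- The crux: `x` lifts to the verbal part of the copies of `F₁`, whose image in `F` lies in `R_V ≤
  -- S_V`.
  have hjV : ∀ x ∈ copiesVerbal V A B, j x = 1 := by
    intro x hx
    obtain ⟨y, hy, rfl⟩ := exists_mem_copiesVerbal_copiesMap_eq V ν₁ hν₁ hx
    exact (DFunLike.congr_fun hjμ y).trans (hST _ (Subgroup.mem_sup_right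
      ⟨_, copiesVerbal_map_copiesToFreeBase_le V ν₂ s hs ⟨y, hy, rfl⟩, rfl⟩))
  let ψ : VerbalWreath V A B →* Coprod F₁ B ⧸ verbalT V ν₁ ν₂ :=
    SemidirectProduct.lift (QuotientGroup.lift _ j hjV) (q.comp Coprod.inr) <| by
      intro b
      refine QuotientGroup.monoidHom_ext _ (CoprodI.ext_hom _ _ fun x => MonoidHom.ext fun f => ?_)
      change j (copiesAction A B b (CoprodI.of f)) =
        q (Coprod.inr b) * j (CoprodI.of f) * (q (Coprod.inr b))⁻¹
      rw [copiesAction_of, hj, hj]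
      simp [mul_assoc]
  have hψ : ψ.comp (coprodToWreath V ν₁) = q := by
    refine Coprod.hom_ext (MonoidHom.ext fun f => ?_) (MonoidHom.ext fun b => ?_)
    · rw [MonoidHom.comp_apply, MonoidHom.comp_apply, coprodToWreath_inl,
        SemidirectProduct.lift_inl]
      refine (QuotientGroup.lift_mk' (copiesVerbal V A B) hjV _).trans ?_
      rw [hj, ha]
      simp
    · rw [MonoidHom.comp_apply, MonoidHom.comp_apply, coprodToWreath_inr,
        SemidirectProduct.lift_inr]
  intro x hx
  rw [← QuotientGroup.eq_one_iff]
  change q x = 1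
  rw [← hψ, MonoidHom.comp_apply, MonoidHom.mem_ker.1 hx, map_one]

end Wreath

/-! ### Lifting between presentations, and the theorem -/

theorem IsFreeGroup.exists_comp_eq {P E G : Type*} [Group P] [Group E] [Group G] [IsFreeGroup P]
    (π : P →* G) (ε : E →* G) (hε : Function.Surjective ε) : ∃ f : P →* E, ε.comp f = π := by
  choose s hs using hε
  exact ⟨IsFreeGroup.lift fun x => s (π (IsFreeGroup.of x)),
    IsFreeGroup.ext_hom fun x => by simp [hs]⟩

theorem Monoid.Coprod.exists_comp_eq {P₁ P₂ E G : Type*} [Group P₁] [Group P₂] [Group E] [Group G]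
    [IsFreeGroup P₁] [IsFreeGroup P₂] (π : Coprod P₁ P₂ →* G) (ε : E →* G)
    (hε : Function.Surjective ε) : ∃ f : Coprod P₁ P₂ →* E, ε.comp f = π := by
  obtain ⟨f₁, h₁⟩ := IsFreeGroup.exists_comp_eq (π.comp Coprod.inl) ε hε
  obtain ⟨f₂, h₂⟩ := IsFreeGroup.exists_comp_eq (π.comp Coprod.inr) ε hε
  refine ⟨Coprod.lift f₁ f₂, Coprod.hom_ext ?_ ?_⟩
  · rw [← h₁]; ext; simp
  · rw [← h₂]; ext; simp

theorem exists_surjective_nilpotentMultiplier {A B F₁ F₂ P Q : Type*} [Group A] [Group B]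
    [Group F₁] [Group F₂] [Group P] [Group Q] [IsFreeGroup F₁] [IsFreeGroup F₂] [IsFreeGroup P]
    [IsFreeGroup Q] (V : Set (FreeGroup ℕ)) (c : ℕ)
    (ν₁ : F₁ →* A) (hν₁ : Function.Surjective ν₁) (ν₂ : F₂ →* B) (hν₂ : Function.Surjective ν₂)
    (π : P →* VerbalWreath V A B) (hπ : Function.Surjective π)
    (ρ : Q →* B) (hρ : Function.Surjective ρ) :
    ∃ φ : NilpotentMultiplier c π →*
        NilpotentMultiplier c ρ × GammaQuotient c (verbalT V ν₁ ν₂) (verbalT_normal V ν₁ ν₂ hν₂),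
      Function.Surjective φ := by
  have hT := ker_coprodToWreath V ν₁ ν₂ hν₁ hν₂
  let δ := deltaHom F₁ ν₂
  have hδ : Function.Surjective δ := deltaHom_surjective ν₂ hν₂
  let κ := coprodToWreath V ν₁ (B := B)
  let ε : Coprod F₁ F₂ →* VerbalWreath V A B := κ.comp δ
  have hε : Function.Surjective ε := (coprodToWreath_surjective V ν₁ hν₁).comp hδ
  let r : Coprod F₁ F₂ →* F₂ := Coprod.lift 1 (MonoidHom.id F₂)
  have hr : ∀ x, ν₂ (r x) = SemidirectProduct.rightHom (ε x) := fun x => by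
    suffices h : ν₂.comp r = SemidirectProduct.rightHom.comp ε from DFunLike.congr_fun h x
    refine Coprod.hom_ext ?_ ?_ <;> ext y <;>
      simp [r, ε, κ, δ, deltaHom, coprodToWreath_inl, coprodToWreath_inr]
  obtain ⟨α, hα⟩ := IsFreeGroup.exists_comp_eq π ε hε
  obtain ⟨β, hβ⟩ := Coprod.exists_comp_eq ε π hπ
  obtain ⟨θ, hθ⟩ := IsFreeGroup.exists_comp_eq ν₂ ρ hρ
  obtain ⟨θ', hθ'⟩ := IsFreeGroup.exists_comp_eq ρ ν₂ hν₂
  replace hα : ∀ x, ε (α x) = π x := DFunLike.congr_fun hα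
  replace hβ : ∀ x, π (β x) = ε x := DFunLike.congr_fun hβ
  replace hθ : ∀ x, ρ (θ x) = ν₂ x := DFunLike.congr_fun hθ
  replace hθ' : ∀ x, ν₂ (θ' x) = ρ x := DFunLike.congr_fun hθ'
  have h₁ : π.ker.map ((θ.comp r).comp α) ≤ ρ.ker := by
    rintro _ ⟨x, hx, rfl⟩
    rw [MonoidHom.mem_ker, MonoidHom.comp_apply, MonoidHom.comp_apply, hθ, hr, hα,
      MonoidHom.mem_ker.1 hx, map_one]
  have h₂ : π.ker.map (δ.comp α) ≤ verbalT V ν₁ ν₂ := by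
    rintro _ ⟨x, hx, rfl⟩
    rw [← hT, MonoidHom.mem_ker]
    exact (hα x).trans hx
  refine ⟨(GammaQuotient.map _ (MonoidHom.normal_ker ρ) _ h₁).prod
    (GammaQuotient.map _ (verbalT_normal V ν₁ ν₂ hν₂) _ h₂), ?_⟩
  rintro ⟨x, t⟩
  obtain ⟨⟨x, hx, hxc⟩, rfl⟩ := GammaQuotient.mk_surjective _ x
  obtain ⟨⟨t, ht, htc⟩, rfl⟩ := GammaQuotient.mk_surjective _ t
  obtain ⟨g, hg, rfl⟩ : t ∈ ((⊤ : Subgroup _).lowerCentralSeries c).map δ := by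
    rwa [lowerCentralSeries_top_map_eq δ hδ]
  have hx : ρ x = 1 := hx
  have hg1 : ε g = 1 := by rw [← hT] at ht; exact ht
  have hrg : ν₂ (r g) = 1 := by rw [hr, hg1, map_one]
  have hinr : ∀ u, δ (Coprod.inr u) = Coprod.inr (ν₂ u) := fun u => by simp [δ, deltaHom]
  -- The correcting factor replaces the `F₂`-part of `g` by `θ' x`. It lies in `R₂`, so `δ` kills
  -- it, and it lies in `γ_{c+1}`.
  let n : Coprod F₁ F₂ := g * Coprod.inr ((r g)⁻¹ * θ' x)
  have hδn : δ n = δ g := by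
    rw [map_mul, hinr, map_mul, map_inv, hrg, hθ', hx, inv_one, one_mul, map_one, mul_one]
  have hrn : r n = θ' x := by simp [n, r]
  have hnc : n ∈ (⊤ : Subgroup _).lowerCentralSeries c :=
    mul_mem hg (lowerCentralSeries_top_map_le Coprod.inr c ⟨_, mul_mem
      (inv_mem (lowerCentralSeries_top_map_le r c ⟨g, hg, rfl⟩))
      (lowerCentralSeries_top_map_le θ' c ⟨x, hxc, rfl⟩), rfl⟩)
  have hεn : ε n = 1 := by
    rw [← hg1]
    exact congrArg κ hδn
  refine ⟨GammaQuotient.mk _ ⟨β n, (hβ n).trans hεn,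
    lowerCentralSeries_top_map_le β c ⟨n, hnc, rfl⟩⟩, Prod.ext ?_ ?_⟩
  · refine (GammaQuotient.mk_eq_iff _).2 ?_
    -- The round trips `α ∘ β` and `θ ∘ θ'` are not identities, but they respect the maps to the
    -- base groups, so on `γ_{c+1}` they are invisible in the quotient.
    have e₁ := inv_mul_mem_iterComm (((θ.comp r).comp α).comp β) (θ.comp r) ρ.ker
      (MonoidHom.normal_ker ρ) (fun y => by
        simp [MonoidHom.mem_ker, hθ, hr, hα, hβ]) c hnc
    have e₂ := inv_mul_mem_iterComm (θ.comp θ') (MonoidHom.id Q) ρ.ker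
      (MonoidHom.normal_ker ρ) (fun y => by simp [MonoidHom.mem_ker, hθ, hθ']) c hxc
    have e := mul_mem e₁ e₂
    simp only [MonoidHom.comp_apply, hrn, MonoidHom.id_apply, mul_assoc,
      mul_inv_cancel_left] at e
    exact e
  · refine (GammaQuotient.mk_eq_iff _).2 ?_
    have e := inv_mul_mem_iterComm ((δ.comp α).comp β) δ (verbalT V ν₁ ν₂)
      (verbalT_normal V ν₁ ν₂ hν₂) (fun y => by
        rw [← hT, MonoidHom.mem_ker, map_mul, map_inv]
        change (ε (α (β y)))⁻¹ * ε y = 1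
        rw [hα, hβ, inv_mul_cancel]) c hnc
    rw [hδn] at e
    exact e

theorem theorem4p5 {A B F₁ F₂ P Q : Type*} [Group A] [Group B] [Group F₁] [Group F₂]
    [Group P] [Group Q] [IsFreeGroup F₁] [IsFreeGroup F₂] [IsFreeGroup P] [IsFreeGroup Q]
    (V : Set (FreeGroup ℕ)) (c : ℕ) (hc : 1 ≤ c)
    (ν₁ : F₁ →* A) (hν₁ : Function.Surjective ν₁)
    (ν₂ : F₂ →* B) (hν₂ : Function.Surjective ν₂)
    (π : P →* VerbalWreath V A B) (hπ : Function.Surjective π)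
    (ρ : Q →* B) (hρ : Function.Surjective ρ) :
    (∃ φ : NilpotentMultiplier c π →*
        NilpotentMultiplier c ρ × GammaQuotient c (verbalT V ν₁ ν₂) (verbalT_normal V ν₁ ν₂ hν₂),
      Function.Surjective φ) ∧
    (Finite (VerbalWreath V A B) → Finite (NilpotentMultiplier c π)) ∧
    (Finite (NilpotentMultiplier c π) →
      ∃ L : Subgroup (NilpotentMultiplier c π),
        Nonempty (L ≃* NilpotentMultiplier c ρ ×
          GammaQuotient c (verbalT V ν₁ ν₂) (verbalT_normal V ν₁ ν₂ hν₂))) := by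
  have h := exists_surjective_nilpotentMultiplier V c ν₁ hν₁ ν₂ hν₂ π hπ ρ hρ
  refine ⟨h, fun _ => ?_, fun _ => ?_⟩
  -- Finiteness of the wreath product enters as finite index of `π.ker`.
  · exact GammaQuotient.finite c π.ker (MonoidHom.normal_ker π)
  · obtain ⟨φ, hφ⟩ := h
    let _ : CommGroup (NilpotentMultiplier c π) :=
      { GammaQuotient.group c _ _ with mul_comm := GammaQuotient.mul_comm _ }
    let _ : CommGroup (NilpotentMultiplier c ρ × GammaQuotient c (verbalT V ν₁ ν₂)
        (verbalT_normal V ν₁ ν₂ hν₂)) :=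
      { (inferInstance : Group _) with
        mul_comm := fun x y => Prod.ext (GammaQuotient.mul_comm _ _ _)
          (GammaQuotient.mul_comm _ _ _) }
    exact CommGroup.exists_subgroup_mulEquiv_of_surjective φ hφ
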